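/- For a based space $(Y,y)$ let $\Omega(Y,y)$ be the space of loops in $Y$ based at $y$ with the compact-open topology, and let $\pi_1^{top}(Y,y)$ be the fundamental group $\pi_1(Y,y)$ with the quotient topology with respect to the canonical map $\Omega(Y,y)\to\pi_1(Y,y)$; equivalently, it is the path component space $\pi_0^{top}(\Omega(Y,y))$, where for any space $Z$ the space $\pi_0^{top}(Z)$ is the set of path components of $Z$ with the quotient topology. For a space $X$ let $X_+=X\sqcup\{*\}$ be $X$ with a disjoint basepoint added, and let $$\Sigma(X_+)=\frac{X_+\times[0,1]}{X\times\{0,1\}\cup\{*\}\times[0,1]}$$ be its reduced suspension, based at the image $x_0$ of the collapsed set. For a space $Y$ let $F_M(Y)$ be the free (Markov) topological group on $Y$, that is, the free group on the set $Y$ with the finest group topology for which the canonical injection $Y\to F_M(Y)$ is continuous. **Proposition.** Let $X$ be an arbitrary topological space. Then $\pi_1^{top}(\Sigma(X_+),x_0)$ is a topological group (i.e. multiplication and inversion are continuous) if and only if it is topologically isomorphic (i.e. isomorphic by a group isomorphism that is a homeomorphism) to the free topological group $F_M(\pi_0^{top}(X))$ on the path component space of $X$. -/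

import Mathlib

open scoped unitInterval

universe u v

/-! ### The topological fundamental group -/

section TopologicalFundamentalGroup

variable {Y : Type u} [TopologicalSpace Y]

/-- Two based loops lie in the same path component of the loop space (with the compact-open
topology) exactly when they are homotopic relative to the endpoints. -/
theorem joined_loops_iff_homotopic {y : Y} (p q : LoopSpace Y y) :
    Joined p q ↔ Path.Homotopic p q := by
  constructor
  · rintro ⟨γ⟩
    have hγ : Continuous fun s : I × I => (γ s.1) s.2 :=
      Path.continuous_uncurry_iff.2 γ.continuous
    refine ⟨{ toFun := fun s => (γ s.1) s.2
              continuous_toFun := hγ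
              map_zero_left := fun t => by simp
              map_one_left := fun t => by simp
              prop' := ?_ }⟩
    intro s t ht
    rcases ht with rfl | rfl <;> simp
  · rintro ⟨F⟩
    exact ⟨{ toFun := fun s => F.eval s
             continuous_toFun := by
               apply Path.continuous_uncurry_iff.1
               exact F.continuous
             source' := F.eval_zero
             target' := F.eval_one }⟩

/-- The topological fundamental group of `(Y, y)`: the path component space of the space
of loops based at `y`, where the loop space carries the compact-open topology. -/
def TopFundamentalGroup (Y : Type u) [TopologicalSpace Y] (y : Y) : Type u :=
  ZerothHomotopy (LoopSpace Y y)

namespace TopFundamentalGroup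

variable {y : Y}

/-- The quotient topology inherited from the loop space. -/
instance : TopologicalSpace (TopFundamentalGroup Y y) :=
  inferInstanceAs (TopologicalSpace (ZerothHomotopy (LoopSpace Y y)))

/-- The class of a loop. -/
def mk (p : LoopSpace Y y) : TopFundamentalGroup Y y := ZerothHomotopy.mk p

theorem mk_eq_of_homotopic {p q : LoopSpace Y y} (h : Path.Homotopic p q) : mk p = mk q :=
  Quotient.sound ((joined_loops_iff_homotopic p q).2 h)

theorem ind {motive : TopFundamentalGroup Y y → Prop} (h : ∀ p, motive (mk p))
    (a : TopFundamentalGroup Y y) : motive a :=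
  Quotient.ind h a

/-- The product is induced by concatenation of loops, `[p] * [q] = [p * q]`. -/
noncomputable instance : Mul (TopFundamentalGroup Y y) where
  mul := Quotient.map₂ (fun p q : Path y y => p.trans q) fun p p' hp q q' hq =>
    (joined_loops_iff_homotopic _ _).2
      (((joined_loops_iff_homotopic p p').1 hp).hcomp ((joined_loops_iff_homotopic q q').1 hq))

instance : One (TopFundamentalGroup Y y) where
  one := mk (Path.refl y)

/-- The inverse is induced by reversal of loops. -/
instance : Inv (TopFundamentalGroup Y y) where
  inv := Quotient.map (fun p : Path y y => p.symm) fun p p' hp =>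
    (joined_loops_iff_homotopic _ _).2 ((joined_loops_iff_homotopic p p').1 hp).symm₂

theorem mk_mul_mk (p q : Path y y) :
    (mk p * mk q : TopFundamentalGroup Y y) = mk (p.trans q) := rfl

theorem one_eq_mk : (1 : TopFundamentalGroup Y y) = mk (Path.refl y) := rfl

theorem inv_mk (p : Path y y) : (mk p : TopFundamentalGroup Y y)⁻¹ = mk p.symm := rfl

noncomputable instance : Group (TopFundamentalGroup Y y) :=
  Group.ofLeftAxioms
    (fun a b c => by
      induction a using ind with | _ p
      induction b using ind with | _ q
      induction c using ind with | _ r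
      exact mk_eq_of_homotopic ⟨Path.Homotopy.transAssoc p q r⟩)
    (fun a => by
      induction a using ind with | _ p
      exact mk_eq_of_homotopic ⟨Path.Homotopy.reflTrans p⟩)
    (fun a => by
      induction a using ind with | _ p
      exact mk_eq_of_homotopic ⟨(Path.Homotopy.reflSymmTrans p).symm⟩)

end TopFundamentalGroup

end TopologicalFundamentalGroup

/-! ### The reduced suspension -/

section Suspension

/-- The subset `Z × {0, 1} ∪ {z} × I` of `Z × I`. -/
def suspensionCollapse {Z : Type u} (z : Z) : Set (Z × I) :=
  {p | p.2 = 0 ∨ p.2 = 1 ∨ p.1 = z}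

/-- The relation on `Z × I` that identifies all points of `Z × {0, 1} ∪ {z} × I` with each other
and no other distinct points. -/
def suspensionSetoid {Z : Type u} (z : Z) : Setoid (Z × I) where
  r p q := p = q ∨ (p ∈ suspensionCollapse z ∧ q ∈ suspensionCollapse z)
  iseqv :=
    { refl := fun _ => Or.inl rfl
      symm := by
        rintro p q (h | ⟨hp, hq⟩)
        · exact Or.inl h.symm
        · exact Or.inr ⟨hq, hp⟩
      trans := by
        rintro p q r (rfl | ⟨hp, hq⟩) (rfl | ⟨hq', hr⟩)
        · exact Or.inl rfl
        · exact Or.inr ⟨hq', hr⟩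
        · exact Or.inr ⟨hp, hq⟩
        · exact Or.inr ⟨hp, hr⟩ }

/-- The reduced suspension `(Z × I) / (Z × {0, 1} ∪ {z} × I)` of a based space `(Z, z)`. -/
def ReducedSuspension (Z : Type u) (z : Z) : Type u :=
  Quotient (suspensionSetoid z)

/-- The quotient topology. -/
instance {Z : Type u} [TopologicalSpace Z] {z : Z} : TopologicalSpace (ReducedSuspension Z z) :=
  inferInstanceAs (TopologicalSpace (Quotient (suspensionSetoid z)))

/-- The canonical basepoint of the reduced suspension, the image of the collapsed set. -/
def ReducedSuspension.base (Z : Type u) (z : Z) : ReducedSuspension Z z :=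
  Quotient.mk (suspensionSetoid z) (z, 0)

/-- The space `X₊ = X ⊔ {*}`, with the topology of a disjoint union. -/
abbrev AddDisjointPoint (X : Type u) : Type u := X ⊕ PUnit.{u + 1}

/-- The added point `*` of `X₊`. -/
abbrev AddDisjointPoint.pt (X : Type u) : AddDisjointPoint X := Sum.inr PUnit.unit

/-- The space `Σ(X₊)`. -/
abbrev SuspensionPlus (X : Type u) : Type u :=
  ReducedSuspension (AddDisjointPoint X) (AddDisjointPoint.pt X)

/-- The canonical basepoint of `Σ(X₊)`. -/
abbrev SuspensionPlus.base (X : Type u) : SuspensionPlus X :=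
  ReducedSuspension.base (AddDisjointPoint X) (AddDisjointPoint.pt X)

end Suspension

/-! ### The free (Markov) topological group -/

section FreeTopologicalGroup

/-- The free (Markov) topological group on a space `Y`: the free group on the underlying set
of `Y`, with the finest group topology for which the canonical injection of `Y` is continuous. -/
def FreeTopologicalGroup (Y : Type u) : Type u := FreeGroup Y

namespace FreeTopologicalGroup

instance {Y : Type u} : Group (FreeTopologicalGroup Y) :=
  inferInstanceAs (Group (FreeGroup Y))

/-- The canonical injection `Y → F_M(Y)`. -/
def of {Y : Type u} (y : Y) : FreeTopologicalGroup Y := FreeGroup.of y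

/-- The group topologies for which the canonical injection is continuous. -/
def admissibleTopologies (Y : Type u) [TopologicalSpace Y] :
    Set (TopologicalSpace (FreeTopologicalGroup Y)) :=
  {t | @IsTopologicalGroup (FreeTopologicalGroup Y) t _ ∧
    @Continuous Y (FreeTopologicalGroup Y) _ t of}

variable {Y : Type u} [TopologicalSpace Y]

/-- In the order on topologies, smaller means finer; the infimum is itself admissible by the
next two facts, so it is the finest admissible topology. -/
instance : TopologicalSpace (FreeTopologicalGroup Y) := sInf (admissibleTopologies Y)

instance : IsTopologicalGroup (FreeTopologicalGroup Y) :=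
  topologicalGroup_sInf fun _ ht => ht.1

theorem continuous_of : Continuous (of : Y → FreeTopologicalGroup Y) :=
  continuous_sInf_rng.2 fun _ ht => ht.2

/-- The universal property that characterizes the free topological group. -/
theorem existsUnique_lift {G : Type v} [Group G] [TopologicalSpace G] [IsTopologicalGroup G]
    (f : Y → G) (hf : Continuous f) :
    ∃! F : FreeTopologicalGroup Y →ₜ* G, ∀ y, F (of y) = f y := by
  let φ : FreeTopologicalGroup Y →* G := FreeGroup.lift f
  have hφ : ∀ y, φ (of y) = f y := fun y => FreeGroup.lift_apply_of
  have hmem : TopologicalSpace.induced φ inferInstance ∈ admissibleTopologies Y := by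
    refine ⟨topologicalGroup_induced φ, continuous_induced_rng.2 ?_⟩
    exact hf.congr fun y => (hφ y).symm
  have hc : Continuous φ := continuous_iff_le_induced.2 (sInf_le hmem)
  refine ⟨⟨φ, hc⟩, hφ, fun F hF => ?_⟩
  have h : (F : FreeTopologicalGroup Y →* G) = φ :=
    FreeGroup.ext_hom (F : FreeTopologicalGroup Y →* G) φ
      fun y => (hF y).trans (hφ y).symm
  exact ContinuousMonoidHom.ext fun x => DFunLike.congr_fun h x

end FreeTopologicalGroup

end FreeTopologicalGroup

/-!
Write `D` for a group and let `f : π₀(X) → D` be any function. The suspension `Σ(X₊)` is covered by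
the open cylinder `X × (0, 1)` and by an open cone neighbourhood of the basepoint, which is what
remains after removing `X × [1/3, 2/3]`. Their overlap has a lower part and an upper part, and the
function that is `1` on the lower part and `f [x]` on the upper part glues trivial bundles to a
principal `D`-bundle over `Σ(X₊)`. Its holonomy along the arc over `x` is `f [x]`
(`holonomy_arcClass`).

The transition function is in general not locally constant, because `X` need not be locally path
connected. It is constant along paths, so after pulling back along a map from a square it becomes
locally constant there, the pulled back bundle is a covering of the square, and it has a section
(`exists_isFlat_square`). This gives unique flat sections along loops and the homotopy invariance
of holonomy, hence a homomorphism `holonomy f : π₁(Σ(X₊)) → D`. If `D` is a topological group and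
`f` is continuous, then `holonomy f` is continuous on `π₁` with its quotient topology, because
along a subdivision of a loop the parallel transport is a product of values of the transition
function at points that depend continuously on the loop (`continuous_holonomy`).

For `D = F_M(π₀(X))` and `f` the canonical injection this is a continuous homomorphism
`π₁(Σ(X₊)) → F_M(π₀(X))`, with no assumption on `π₁`. When `π₁` is a topological group, the
universal property extends the continuous map `x ↦ [arc over x]` to a continuous homomorphism in
the other direction. The two are mutually inverse: one composite is the identity on the free
generators, the other one on the classes of the arcs, and these generate `π₁`
(`closure_range_arcClass`).
-/

open Set Topology

/-! ### Locally constant functions and flat sections -/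

instance unitInterval.contractibleSpace : ContractibleSpace I :=
  (convex_Icc (0 : ℝ) 1).contractibleSpace ⟨0, by simp⟩

instance unitInterval.locallyPathConnectedSpace : LocallyPathConnectedSpace I :=
  Topology.IsQuotientMap.locallyPathConnectedSpace
    (f := Set.projIcc (0 : ℝ) 1 zero_le_one) isQuotientMap_projIcc

theorem continuousOn_of_forall_path_eq {T D : Type*} [TopologicalSpace T]
    [LocallyPathConnectedSpace T] [TopologicalSpace D] {W : Set T} (hW : IsOpen W) {θ : T → D}
    (h : ∀ (a b : T) (γ : Path a b), (∀ t, γ t ∈ W) → θ a = θ b) : ContinuousOn θ W := by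
  intro a ha
  obtain ⟨N, ⟨hN, hpc⟩, hNW⟩ := (path_connected_basis a).mem_iff.1 (hW.mem_nhds ha)
  have hθ : ∀ᶠ b in 𝓝 a, θ a = θ b := by
    filter_upwards [hN] with b hb
    obtain ⟨γ, hγ⟩ := hpc.joinedIn a (mem_of_mem_nhds hN) b hb
    exact h a b γ fun t => hNW (hγ t)
  exact (continuousAt_const.congr hθ).continuousWithinAt

/-- A principal bundle with discrete structure group `D` over a simply connected, locally path
connected space, trivial over two open sets `U` and `V` with transition function `θ`, has a
global section: `g` is its expression over `V`, and `g * θ⁻¹` its expression over `U`. -/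
theorem exists_flat_section {T D : Type*} [TopologicalSpace T] [SimplyConnectedSpace T]
    [LocallyPathConnectedSpace T] [Group D] [TopologicalSpace D] [DiscreteTopology D]
    {U V : Set T} (hU : IsOpen U) (hV : IsOpen V) (hUV : ∀ t, t ∈ U ∨ t ∈ V)
    {θ : T → D} (hθ : ContinuousOn θ (U ∩ V)) :
    ∃ g : T → D, ContinuousOn g V ∧ ContinuousOn (fun t => g t * (θ t)⁻¹) U := by
  classical
  -- `c i` converts from the frame over `V` to the frame with index `i`; `true` stands for `V`.
  let c : Bool → T → D := fun i t => bif i then 1 else (θ t)⁻¹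
  let Z : FiberBundleCore Bool T D :=
    { baseSet := fun i => bif i then V else U
      isOpen_baseSet := by rintro (_ | _) <;> assumption
      indexAt := fun t => decide (t ∈ V)
      mem_baseSet_at := fun t => by
        by_cases ht : t ∈ V
        · simp [ht]
        · simpa [ht] using (hUV t).resolve_right ht
      coordChange := fun i j t v => v * (c i t)⁻¹ * c j t
      coordChange_self := fun i t _ v => by simp
      continuousOn_coordChange := by
        have h1 : ContinuousOn (fun p : T × D => θ p.1) ((U ∩ V) ×ˢ univ) :=
          hθ.comp continuousOn_fst fun p hp => hp.1
        have h2 : ContinuousOn (fun p : T × D => θ p.1) ((V ∩ U) ×ˢ univ) := by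
          rwa [inter_comm]
        rintro (_ | _) (_ | _)
        · simpa [c] using continuousOn_snd
        · simpa [c] using! continuousOn_snd.mul h1
        · simpa [c] using! continuousOn_snd.mul h2.inv
        · simpa [c] using continuousOn_snd
      coordChange_comp := fun i j k t _ v => by group }
  have hcov : IsCoveringMap Z.proj := FiberBundle.isCoveringMap (F := D) (E := Z.Fiber)
  obtain ⟨a₀⟩ : Nonempty T := inferInstance
  obtain ⟨Γ, ⟨-, hΓ⟩, -⟩ := hcov.existsUnique_continuousMap_lifts (ContinuousMap.id T) a₀
    (⟨a₀, (1 : D)⟩ : Z.TotalSpace) rfl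
  have hproj : ∀ t, (Γ t).proj = t := fun t => congrFun hΓ t
  let v : T → D := fun t => (Γ t).snd
  let g : T → D := fun t => v t * (c (Z.indexAt (Γ t).proj) (Γ t).proj)⁻¹
  have key : ∀ i, ContinuousOn (fun t => g t * c i t) (Z.baseSet i) := by
    intro i
    have h : ContinuousOn (fun t => (Z.localTriv i (Γ t)).2) (Z.baseSet i) :=
      continuous_snd.comp_continuousOn
        ((Z.localTriv i).continuousOn_toFun.comp Γ.continuous.continuousOn fun t ht => by
          change (Γ t).proj ∈ Z.baseSet i
          rwa [hproj])
    refine h.congr fun t _ => ?_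
    change v t * (c (Z.indexAt (Γ t).proj) (Γ t).proj)⁻¹ * c i t =
      v t * (c (Z.indexAt (Γ t).proj) (Γ t).proj)⁻¹ * c i (Γ t).proj
    rw [hproj]
  exact ⟨g, (key true).congr fun t _ => (mul_one (g t)).symm, key false⟩

/-- Induction along the unit interval, over a subdivision subordinate to an open cover. -/
theorem unitInterval.induction_of_open_cover {U V : Set I} (hU : IsOpen U) (hV : IsOpen V)
    (hUV : ∀ t, t ∈ U ∨ t ∈ V) {P : I → Prop} (h0 : P 0)
    (hPU : ∀ s t, s ≤ t → Icc s t ⊆ U → P s → P t)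
    (hPV : ∀ s t, s ≤ t → Icc s t ⊆ V → P s → P t) : P 1 := by
  obtain ⟨t, ht0, hmono, ⟨n, hn⟩, hsub⟩ :=
    exists_monotone_Icc_subset_open_cover_unitInterval (c := fun i : Bool => bif i then V else U)
      (by rintro (_ | _) <;> assumption)
      (fun s _ => mem_iUnion.2 <| (hUV s).elim (fun h => ⟨false, h⟩) fun h => ⟨true, h⟩)
  have : ∀ k, P (t k) := by
    intro k
    induction k with
    | zero => rwa [ht0]
    | succ k ih =>
      obtain ⟨_ | _, hi⟩ := hsub k
      · exact hPU _ _ (hmono k.le_succ) hi ih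
      · exact hPV _ _ (hmono k.le_succ) hi ih
  exact hn n le_rfl ▸ this n

/-! ### The suspension `Σ(X₊)` and its two-piece open cover -/

namespace SuspensionPlus

variable {X : Type u}

/-- The quotient map `X₊ × I → Σ(X₊)`. -/
def proj : AddDisjointPoint X × I → SuspensionPlus X := Quotient.mk (suspensionSetoid _)

theorem proj_inr (t : I) : proj (AddDisjointPoint.pt X, t) = base X :=
  Quotient.sound (Or.inr ⟨Or.inr (Or.inr rfl), Or.inl rfl⟩)

/-- The point of `Σ(X₊)` on the arc over `x`, at height `t`. -/
def mk (x : X) (t : I) : SuspensionPlus X := proj (Sum.inl x, t)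

theorem mk_zero (x : X) : mk x 0 = base X := Quotient.sound (Or.inr ⟨Or.inl rfl, Or.inl rfl⟩)

theorem mk_one (x : X) : mk x 1 = base X :=
  Quotient.sound (Or.inr ⟨Or.inr (Or.inl rfl), Or.inl rfl⟩)

theorem eq_base_or_eq_mk (b : SuspensionPlus X) : b = base X ∨ ∃ x t, b = mk x t := by
  induction b using Quotient.ind with | _ p
  obtain ⟨x | ⟨⟩, t⟩ := p
  · exact Or.inr ⟨x, t, rfl⟩
  · exact Or.inl (proj_inr t)

theorem mk_eq_mk_iff {x y : X} {s t : I} :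
    mk x s = mk y t ↔ (x = y ∧ s = t) ∨ ((s = 0 ∨ s = 1) ∧ (t = 0 ∨ t = 1)) := by
  refine Quotient.eq.trans ?_
  change _ ∨ _ ↔ _
  simp [suspensionCollapse]

theorem base_eq_mk_iff {x : X} {t : I} : base X = mk x t ↔ t = 0 ∨ t = 1 := by
  rw [← mk_zero x, mk_eq_mk_iff]
  aesop

/-- The open cylinder `X × (0, 1)` inside `Σ(X₊)`. -/
def cylinder (X : Type u) : Set (SuspensionPlus X) := {b | ∃ x t, 0 < t ∧ t < 1 ∧ b = mk x t}

/-- The complement of `X × [1/3, 2/3]` in `Σ(X₊)`: a contractible neighbourhood of the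
basepoint. -/
def cone (X : Type u) : Set (SuspensionPlus X) :=
  {b | ∀ x t, b = mk x t → (t : ℝ) < 1 / 3 ∨ 2 / 3 < (t : ℝ)}

theorem base_mem_cone : base X ∈ cone X := by
  intro x t h
  rcases base_eq_mk_iff.1 h with rfl | rfl <;> norm_num

theorem mk_mem_cylinder {x : X} {t : I} : mk x t ∈ cylinder X ↔ 0 < t ∧ t < 1 := by
  refine ⟨?_, fun h => ⟨x, t, h.1, h.2, rfl⟩⟩
  rintro ⟨y, s, h0, h1, h⟩
  rcases mk_eq_mk_iff.1 h with ⟨-, rfl⟩ | ⟨-, rfl | rfl⟩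
  · exact ⟨h0, h1⟩
  · exact absurd h0 (lt_irrefl _)
  · exact absurd h1 (lt_irrefl _)

theorem mk_mem_cone {x : X} {t : I} :
    mk x t ∈ cone X ↔ (t : ℝ) < 1 / 3 ∨ 2 / 3 < (t : ℝ) := by
  refine ⟨fun h => h x t rfl, fun h y s hs => ?_⟩
  rcases mk_eq_mk_iff.1 hs with ⟨-, rfl⟩ | ⟨-, rfl | rfl⟩
  · exact h
  all_goals norm_num

theorem mem_cylinder_or_mem_cone (b : SuspensionPlus X) : b ∈ cylinder X ∨ b ∈ cone X := by
  rcases eq_base_or_eq_mk b with rfl | ⟨x, t, rfl⟩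
  · exact Or.inr base_mem_cone
  · rw [mk_mem_cylinder, mk_mem_cone, ← unitInterval.coe_pos, ← unitInterval.coe_lt_one]
    by_contra! h
    have := h.2.2
    have := h.1 (by linarith [h.2.1])
    linarith

theorem base_notMem_cylinder : base X ∉ cylinder X := by
  rintro ⟨x, t, h0, h1, h⟩
  rcases base_eq_mk_iff.1 h with rfl | rfl
  · exact lt_irrefl _ h0
  · exact lt_irrefl _ h1

theorem range_mk : (range fun p : X × Ioo (0 : I) 1 => mk p.1 (p.2 : I)) = cylinder X := by
  ext b
  constructor
  · rintro ⟨p, rfl⟩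
    exact mk_mem_cylinder.2 p.2.2
  · rintro ⟨x, t, h0, h1, rfl⟩
    exact ⟨(x, ⟨t, h0, h1⟩), rfl⟩

section Topology

variable [TopologicalSpace X]

theorem isQuotientMap_proj : IsQuotientMap (proj : AddDisjointPoint X × I → SuspensionPlus X) :=
  isQuotientMap_quotient_mk'

theorem continuous_mk : Continuous fun p : X × I => mk p.1 p.2 :=
  isQuotientMap_proj.continuous.comp
    ((continuous_inl.comp continuous_fst).prodMk continuous_snd)

theorem isOpenEmbedding_mk :
    IsOpenEmbedding fun p : X × Ioo (0 : I) 1 => mk p.1 (p.2 : I) := by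
  refine .of_continuous_injective_isOpenMap
    (continuous_mk.comp (continuous_fst.prodMk (continuous_subtype_val.comp continuous_snd))) ?_ ?_
  · rintro ⟨x, s, hs⟩ ⟨y, t, ht⟩ h
    rcases mk_eq_mk_iff.1 h with ⟨rfl, h⟩ | ⟨-, h | h⟩
    · cases h
      rfl
    · exact absurd h ht.1.ne'
    · exact absurd h ht.2.ne
  · intro W hW
    rw [← isQuotientMap_proj.isOpen_preimage]
    have hemb : IsOpenEmbedding (Prod.map Sum.inl Subtype.val :
        X × Ioo (0 : I) 1 → AddDisjointPoint X × I) :=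
      .prodMap .inl isOpen_Ioo.isOpenEmbedding_subtypeVal
    convert hemb.isOpenMap W hW
    ext ⟨x | ⟨⟩, t⟩
    · constructor
      · rintro ⟨⟨y, s, hs⟩, hW, h⟩
        rcases mk_eq_mk_iff.1 h with ⟨rfl, rfl⟩ | ⟨h | h, -⟩
        · exact ⟨_, hW, rfl⟩
        · exact absurd h hs.1.ne'
        · exact absurd h hs.2.ne
      · rintro ⟨⟨y, s, hs⟩, hW, h⟩
        cases h
        exact ⟨_, hW, rfl⟩
    · constructor
      · rintro ⟨⟨y, s, hs⟩, hW, h⟩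
        have h' : base X = mk y s := (h.trans (proj_inr t)).symm
        exact absurd (h' ▸ mk_mem_cylinder.2 hs) base_notMem_cylinder
      · rintro ⟨⟨y, s, hs⟩, hW, h⟩
        cases h

theorem isOpen_cylinder : IsOpen (cylinder X) := range_mk (X := X) ▸ isOpenEmbedding_mk.isOpen_range

theorem isOpen_cone : IsOpen (cone X) := by
  rw [← isQuotientMap_proj.isOpen_preimage]
  have hcl : IsClosed ((range (Sum.inl : X → AddDisjointPoint X)) ×ˢ
      {t : I | 1 / 3 ≤ (t : ℝ) ∧ (t : ℝ) ≤ 2 / 3}) :=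
    isClosed_range_inl.prod
      ((isClosed_le continuous_const continuous_subtype_val).inter
        (isClosed_le continuous_subtype_val continuous_const))
  convert hcl.isOpen_compl
  ext ⟨x | ⟨⟩, t⟩
  · refine mk_mem_cone.trans ?_
    simp only [mem_compl_iff, mem_prod, mem_range_self, mem_ofPred_eq, true_and, not_and_or, not_le]
  · have h' := base_mem_cone (X := X)
    rw [← proj_inr t] at h'
    simpa using h'

/-- Continuous maps into the open cylinder have continuous coordinates. -/
theorem exists_coordinates {T : Type*} [TopologicalSpace T] {φ : T → SuspensionPlus X}
    (hφ : Continuous φ) (h : ∀ t, φ t ∈ cylinder X) :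
    ∃ (x : C(T, X)) (s : C(T, I)), ∀ t, 0 < s t ∧ s t < 1 ∧ φ t = mk (x t) (s t) := by
  simp only [← range_mk] at h
  let e := isOpenEmbedding_mk (X := X).isEmbedding.toHomeomorph
  let ψ : C(T, X × Ioo (0 : I) 1) :=
    ⟨fun t => e.symm ⟨φ t, h t⟩, e.symm.continuous.comp (hφ.subtype_mk h)⟩
  refine ⟨⟨fun t => (ψ t).1, by fun_prop⟩, ⟨fun t => (ψ t).2, by fun_prop⟩, fun t =>
    ⟨(ψ t).2.2.1, (ψ t).2.2.2, ?_⟩⟩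
  exact congrArg Subtype.val (e.apply_symm_apply ⟨φ t, h t⟩).symm

end Topology

/-! ### The transition function -/

variable [TopologicalSpace X] {D : Type v} [Group D]

/-- The transition function attached to `f : π₀(X) → D`: it is `f [x]` on the upper half of the arc
over `x`, and `1` elsewhere. Only its values on the overlap of the cylinder and the cone are
constrained; the values elsewhere are a convention. -/
noncomputable def transition (f : ZerothHomotopy X → D) : SuspensionPlus X → D :=
  Quotient.lift
    (fun p => Sum.elim
      (fun x => open Classical in
        if 1 / 2 < (p.2 : ℝ) ∧ (p.2 : ℝ) < 1 then f (ZerothHomotopy.mk x) else 1)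
      (fun _ => 1) p.1)
    (by
      have key : ∀ p ∈ suspensionCollapse (AddDisjointPoint.pt X), Sum.elim
          (fun x => open Classical in
            if 1 / 2 < (p.2 : ℝ) ∧ (p.2 : ℝ) < 1 then f (ZerothHomotopy.mk x) else 1)
          (fun _ => 1) p.1 = 1 := by
        rintro ⟨x | ⟨⟩, t⟩ h
        · rcases h with h | h | h
          · have h : t = 0 := h
            simp [h]
          · have h : t = 1 := h
            simp [h]
          · cases h
        · rfl
      rintro p q (rfl | ⟨hp, hq⟩)
      · rfl
      · exact (key p hp).trans (key q hq).symm)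

theorem transition_mk_of_le (f : ZerothHomotopy X → D) (x : X) {t : I} (ht : (t : ℝ) ≤ 1 / 2) :
    transition f (mk x t) = 1 :=
  if_neg fun h => h.1.not_ge ht

theorem transition_mk_of_lt (f : ZerothHomotopy X → D) (x : X) {t : I} (ht : 1 / 2 < (t : ℝ))
    (ht1 : (t : ℝ) < 1) : transition f (mk x t) = f (ZerothHomotopy.mk x) :=
  if_pos ⟨ht, ht1⟩

theorem continuousOn_transition [TopologicalSpace D] {f : ZerothHomotopy X → D}
    (hf : Continuous f) : ContinuousOn (transition f) (cylinder X ∩ cone X) := by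
  rintro _ ⟨⟨x, t, h0, h1, rfl⟩, hV⟩
  refine ContinuousAt.continuousWithinAt ?_
  refine (isOpenEmbedding_mk.continuousAt_iff (x := (x, ⟨t, h0, h1⟩))).1 ?_
  have hc : Continuous fun p : X × Ioo (0 : I) 1 => (((p.2 : I)) : ℝ) := by fun_prop
  rcases mk_mem_cone.1 hV with h | h
  · refine (continuousAt_const (y := (1 : D))).congr ?_
    filter_upwards [hc.continuousAt.eventually (gt_mem_nhds h)] with p hp
    exact (transition_mk_of_le f _ (by linarith)).symm
  · refine (hf.comp
      (ZerothHomotopy.isQuotientMap_mk.continuous.comp continuous_fst)).continuousAt.congr ?_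
    filter_upwards [hc.continuousAt.eventually (lt_mem_nhds h)] with p hp
    exact (transition_mk_of_lt f _ (by linarith) (unitInterval.coe_lt_one.2 p.2.2.2)).symm

/-- For an arbitrary `f : π₀(X) → D` the transition function is constant along the paths in the
overlap, although it need not be locally constant there. -/
theorem transition_eq_of_path (f : ZerothHomotopy X → D) {a b : SuspensionPlus X} (γ : Path a b)
    (hγ : ∀ t, γ t ∈ cylinder X ∩ cone X) : transition f a = transition f b := by
  obtain ⟨x, s, h⟩ := exists_coordinates γ.continuous fun t => (hγ t).1
  have hs : ∀ t, (s t : ℝ) < 1 / 3 ∨ 2 / 3 < (s t : ℝ) := fun t =>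
    mk_mem_cone.1 ((h t).2.2 ▸ (hγ t).2)
  have hx : ZerothHomotopy.mk (x 0) = ZerothHomotopy.mk (x 1) :=
    Quotient.sound ⟨⟨x, rfl, rfl⟩⟩
  have hmid : ∀ t, (s t : ℝ) ≠ 1 / 2 := by
    intro t ht
    rcases hs t with h | h <;> linarith
  have hc : Continuous fun t => (s t : ℝ) := by fun_prop
  have ha : a = mk (x 0) (s 0) := γ.source.symm.trans (h 0).2.2
  have hb : b = mk (x 1) (s 1) := γ.target.symm.trans (h 1).2.2
  have hs1 : ∀ t, (s t : ℝ) < 1 := fun t => unitInterval.coe_lt_one.2 (h t).2.1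
  rw [ha, hb]
  rcases le_or_gt (s 0 : ℝ) (1 / 2) with h0 | h0 <;> rcases le_or_gt (s 1 : ℝ) (1 / 2) with h1 | h1
  · rw [transition_mk_of_le f _ h0, transition_mk_of_le f _ h1]
  · obtain ⟨t, ht⟩ := mem_range_of_exists_le_of_exists_ge hc ⟨0, h0⟩ ⟨1, h1.le⟩
    exact absurd ht (hmid t)
  · obtain ⟨t, ht⟩ := mem_range_of_exists_le_of_exists_ge hc ⟨1, h1⟩ ⟨0, h0.le⟩
    exact absurd ht (hmid t)
  · rw [transition_mk_of_lt f _ h0 (hs1 0), transition_mk_of_lt f _ h1 (hs1 1), hx]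

/-! ### Flat sections along paths and holonomy -/

theorem induction_along {β : I → SuspensionPlus X} (hβ : Continuous β) {P : I → Prop} (h0 : P 0)
    (hcyl : ∀ s t, s ≤ t → MapsTo β (Icc s t) (cylinder X) → P s → P t)
    (hcone : ∀ s t, s ≤ t → MapsTo β (Icc s t) (cone X) → P s → P t) : P 1 :=
  unitInterval.induction_of_open_cover (isOpen_cylinder.preimage hβ) (isOpen_cone.preimage hβ)
    (fun t => mem_cylinder_or_mem_cone (β t)) h0 hcyl hcone

section Holonomy

variable {f : ZerothHomotopy X → D}

/-- `g` is a flat section, along `β`, of the principal `D`-bundle over `Σ(X₊)` glued from trivial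
bundles over the cylinder and the cone by means of `transition f`. Here `g` is written in the frame
over the cone; in the frame over the cylinder it becomes `g * (transition f)⁻¹`. Outside the cone
`g` has no meaning by itself, only this product has. -/
structure IsFlat (f : ZerothHomotopy X → D) (β : I → SuspensionPlus X) (g : I → D) : Prop where
  eq_of_cone : ∀ s t, s ≤ t → MapsTo β (Icc s t) (cone X) → g s = g t
  eq_of_cylinder : ∀ s t, s ≤ t → MapsTo β (Icc s t) (cylinder X) →
    g s * (transition f (β s))⁻¹ = g t * (transition f (β t))⁻¹

theorem IsFlat.const_mul {β : I → SuspensionPlus X} {g : I → D} (h : IsFlat f β g) (d : D) :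
    IsFlat f β fun t => d * g t where
  eq_of_cone s t hst hm := by rw [h.eq_of_cone s t hst hm]
  eq_of_cylinder s t hst hm := by rw [mul_assoc, h.eq_of_cylinder s t hst hm, mul_assoc]

theorem IsFlat.comp_monotone {β : I → SuspensionPlus X} {g : I → D} (h : IsFlat f β g) {φ : I → I}
    (hφ : Monotone φ) (hc : Continuous φ) : IsFlat f (β ∘ φ) (g ∘ φ) := by
  have key : ∀ (s t : I) (S : Set (SuspensionPlus X)), s ≤ t → MapsTo (β ∘ φ) (Icc s t) S →
      MapsTo β (Icc (φ s) (φ t)) S := by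
    intro s t S hst hm r hr
    obtain ⟨r', hr', rfl⟩ := intermediate_value_Icc hst hc.continuousOn hr
    exact hm hr'
  exact ⟨fun s t hst hm => h.eq_of_cone _ _ (hφ hst) (key s t _ hst hm),
    fun s t hst hm => h.eq_of_cylinder _ _ (hφ hst) (key s t _ hst hm)⟩

/-- A flat section is determined by its initial value. -/
theorem IsFlat.eq_one_of_eq_zero {β : I → SuspensionPlus X} (hβ : Continuous β) {g g' : I → D}
    (h : IsFlat f β g) (h' : IsFlat f β g') (h0 : g 0 = g' 0) : g 1 = g' 1 := by
  refine induction_along hβ (P := fun t => g t = g' t) h0 ?_ ?_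
  · intro s t hst hm hs
    have e := h.eq_of_cylinder s t hst hm
    rw [hs, h'.eq_of_cylinder s t hst hm] at e
    exact (mul_right_cancel e).symm
  · intro s t hst hm hs
    rw [← h.eq_of_cone s t hst hm, hs, h'.eq_of_cone s t hst hm]

/-- Over a square there is a section that is flat along every path in the square. -/
theorem exists_isFlat_square (f : ZerothHomotopy X → D) (φ : C(I × I, SuspensionPlus X)) :
    ∃ g : I × I → D, ∀ ψ : C(I, I × I), IsFlat f (φ ∘ ψ) (g ∘ ψ) := by
  -- The covering over the square has the discrete fibre `D`.
  let _ : TopologicalSpace D := ⊥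
  have : DiscreteTopology D := ⟨rfl⟩
  have hθ : ContinuousOn (transition f ∘ φ) (φ ⁻¹' cylinder X ∩ φ ⁻¹' cone X) :=
    continuousOn_of_forall_path_eq
      ((isOpen_cylinder.preimage φ.continuous).inter (isOpen_cone.preimage φ.continuous))
      fun a b γ hγ => transition_eq_of_path f (γ.map φ.continuous) hγ
  obtain ⟨g, hV, hU⟩ := exists_flat_section (isOpen_cylinder.preimage φ.continuous)
    (isOpen_cone.preimage φ.continuous) (fun t => mem_cylinder_or_mem_cone (φ t)) hθ
  refine ⟨g, fun ψ => ⟨fun s t hst hm => ?_, fun s t hst hm => ?_⟩⟩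
  · exact isPreconnected_Icc.constant (hV.comp ψ.continuous.continuousOn hm)
      (left_mem_Icc.2 hst) (right_mem_Icc.2 hst)
  · exact isPreconnected_Icc.constant (hU.comp ψ.continuous.continuousOn hm)
      (left_mem_Icc.2 hst) (right_mem_Icc.2 hst)

theorem exists_isFlat (f : ZerothHomotopy X → D) {β : I → SuspensionPlus X} (hβ : Continuous β) :
    ∃ g : I → D, IsFlat f β g ∧ g 0 = 1 := by
  obtain ⟨g, hg⟩ := exists_isFlat_square f ⟨fun p => β p.1, hβ.comp continuous_fst⟩
  exact ⟨_, (hg ⟨fun t => (t, 0), by fun_prop⟩).const_mul (g (0, 0))⁻¹, inv_mul_cancel _⟩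

/-- The flat section along a loop that starts at `1`. -/
noncomputable def flatSection (f : ZerothHomotopy X → D) (p : Path (base X) (base X)) : I → D :=
  (exists_isFlat f p.continuous).choose

theorem isFlat_flatSection (f : ZerothHomotopy X → D) (p : Path (base X) (base X)) :
    IsFlat f p (flatSection f p) :=
  (exists_isFlat f p.continuous).choose_spec.1

theorem flatSection_zero (f : ZerothHomotopy X → D) (p : Path (base X) (base X)) :
    flatSection f p 0 = 1 :=
  (exists_isFlat f p.continuous).choose_spec.2

theorem flatSection_one_eq {p : Path (base X) (base X)} {g : I → D} (h : IsFlat f p g) :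
    flatSection f p 1 = (g 0)⁻¹ * g 1 :=
  (isFlat_flatSection f p).eq_one_of_eq_zero p.continuous (h.const_mul (g 0)⁻¹)
    (by rw [flatSection_zero, inv_mul_cancel])

theorem flatSection_one_eq_of_homotopic {p q : Path (base X) (base X)} (h : p.Homotopic q) :
    flatSection f p 1 = flatSection f q 1 := by
  obtain ⟨F⟩ := h
  obtain ⟨g, hg⟩ := exists_isFlat_square f F.toContinuousMap
  have hp : IsFlat f p fun t => g (0, t) := by
    rw [show (p : I → SuspensionPlus X) = fun t => F (0, t) from
      funext fun t => (F.apply_zero t).symm]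
    exact hg ⟨fun t => (0, t), by fun_prop⟩
  have hq : IsFlat f q fun t => g (1, t) := by
    rw [show (q : I → SuspensionPlus X) = fun t => F (1, t) from
      funext fun t => (F.apply_one t).symm]
    exact hg ⟨fun t => (1, t), by fun_prop⟩
  -- The homotopy keeps the endpoints at the basepoint, so `g` is constant along these two sides.
  have h0 : g (0, 0) = g (1, 0) :=
    (hg ⟨fun t => (t, 0), by fun_prop⟩).eq_of_cone 0 1 zero_le_one fun t _ => by
      change F (t, 0) ∈ _
      exact (F.source t).symm ▸ base_mem_cone
  have h1 : g (0, 1) = g (1, 1) :=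
    (hg ⟨fun t => (t, 1), by fun_prop⟩).eq_of_cone 0 1 zero_le_one fun t _ => by
      change F (t, 1) ∈ _
      exact (F.target t).symm ▸ base_mem_cone
  rw [flatSection_one_eq hp, flatSection_one_eq hq, h0, h1]

theorem flatSection_one_trans (f : ZerothHomotopy X → D) (p q : Path (base X) (base X)) :
    flatSection f (p.trans q) 1 = flatSection f p 1 * flatSection f q 1 := by
  -- The flat section along `p.trans q` restricts to flat sections along `p` and along `q`.
  let l : I → I := fun t => ⟨t / 2, by constructor <;> linarith [t.2.1, t.2.2]⟩
  let r : I → I := fun t => ⟨(1 + t) / 2, by constructor <;> linarith [t.2.1, t.2.2]⟩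
  have hl : Monotone l := fun s t (h : (s : ℝ) ≤ t) =>
    show (s / 2 : ℝ) ≤ t / 2 by linarith
  have hr : Monotone r := fun s t (h : (s : ℝ) ≤ t) =>
    show ((1 + s) / 2 : ℝ) ≤ (1 + t) / 2 by linarith
  have hg := isFlat_flatSection f (p.trans q)
  have hpl : p.trans q ∘ l = p := by
    ext t
    have ht : ((l t : I) : ℝ) = t / 2 := rfl
    rw [Function.comp_apply, Path.trans_apply, dif_pos (by linarith [t.2.2])]
    congr 1
    ext
    simp [ht]
    ring
  have hqr : p.trans q ∘ r = q := by
    ext t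
    have ht : ((r t : I) : ℝ) = (1 + t) / 2 := rfl
    rw [Function.comp_apply, Path.trans_apply]
    split_ifs with h
    · have h0 : t = 0 := Subtype.ext (show (t : ℝ) = 0 by linarith [t.2.1])
      subst h0
      rw [q.source]
      convert p.target
      norm_num [ht]
    · congr 1
      ext
      simp [ht]
      ring
  have h1 := hg.comp_monotone hl (by fun_prop)
  have h2 := hg.comp_monotone hr (by fun_prop)
  rw [hpl] at h1
  rw [hqr] at h2
  rw [flatSection_one_eq h1, flatSection_one_eq h2]
  have hl0 : l 0 = 0 := Subtype.ext (by simp [l])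
  have hlr : l 1 = r 0 := Subtype.ext (by simp [l, r])
  have hr1 : r 1 = 1 := Subtype.ext (by norm_num [r])
  simp only [Function.comp_apply, hl0, hlr, hr1, flatSection_zero]
  group

/-- The holonomy of the bundle attached to `f : π₀(X) → D`. -/
noncomputable def holonomy (f : ZerothHomotopy X → D) :
    TopFundamentalGroup (SuspensionPlus X) (base X) →* D :=
  MonoidHom.mk' (Quotient.lift (fun p => flatSection f p 1) fun p q h =>
      flatSection_one_eq_of_homotopic ((joined_loops_iff_homotopic p q).1 h)) (by
    intro a b
    induction a using TopFundamentalGroup.ind with | _ p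
    induction b using TopFundamentalGroup.ind with | _ q
    exact flatSection_one_trans f p q)

/-- The holonomy is continuous as soon as `f` is: for loops `p` near `p₀`, the value at `t` of
the flat section along `p`, in a frame around `p₀ t`, depends continuously on `p`, and this
property propagates along a subdivision of `p₀` subordinate to the cover. -/
theorem continuous_holonomy [TopologicalSpace D] [IsTopologicalGroup D] (hf : Continuous f) :
    Continuous (holonomy f) := by
  refine continuous_quot_lift _ (continuous_iff_continuousAt.2 fun p₀ => ?_)
  have hev : ∀ t : I, Continuous fun p : Path (base X) (base X) => p t := fun t => by fun_prop
  have hmaps : ∀ (s t : I) {S : Set (SuspensionPlus X)}, IsOpen S → MapsTo p₀ (Icc s t) S →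
      ∀ᶠ p : Path (base X) (base X) in 𝓝 p₀, MapsTo p (Icc s t) S := fun s t S hS hm =>
    (continuous_induced_dom (f := fun p : Path (base X) (base X) => (p : C(I, SuspensionPlus X)))
      ).continuousAt.eventually
      ((ContinuousMap.isOpen_setOfPred_mapsTo isCompact_Icc hS).mem_nhds hm)
  have hθ : ∀ t : I, p₀ t ∈ cylinder X → p₀ t ∈ cone X →
      ContinuousAt (fun p : Path (base X) (base X) => transition f (p t)) p₀ := fun t hU hV =>
    ((continuousOn_transition hf).continuousAt
      ((isOpen_cylinder.inter isOpen_cone).mem_nhds ⟨hU, hV⟩)).comp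
        (f := fun p : Path (base X) (base X) => p t) (hev t).continuousAt
  have key := induction_along p₀.continuous
    (P := fun t => (p₀ t ∈ cone X → ContinuousAt (fun p => flatSection f p t) p₀) ∧
      (p₀ t ∈ cylinder X →
        ContinuousAt (fun p => flatSection f p t * (transition f (p t))⁻¹) p₀)) ?_ ?_ ?_
  · exact key.1 (p₀.target.symm ▸ base_mem_cone)
  · refine ⟨fun _ => ?_, fun h => absurd (p₀.source ▸ h) base_notMem_cylinder⟩
    simp only [flatSection_zero]
    exact continuousAt_const
  · intro s t hst hm hs
    have ht : ContinuousAt (fun p => flatSection f p t * (transition f (p t))⁻¹) p₀ := by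
      refine (hs.2 (hm (left_mem_Icc.2 hst))).congr ?_
      filter_upwards [hmaps s t isOpen_cylinder hm] with p hp
      exact (isFlat_flatSection f p).eq_of_cylinder s t hst hp
    refine ⟨fun h => ?_, fun _ => ht⟩
    exact (ht.mul (hθ t (hm (right_mem_Icc.2 hst)) h)).congr
      (.of_forall fun p => inv_mul_cancel_right _ _)
  · intro s t hst hm hs
    have ht : ContinuousAt (fun p => flatSection f p t) p₀ := by
      refine (hs.1 (hm (left_mem_Icc.2 hst))).congr ?_
      filter_upwards [hmaps s t isOpen_cone hm] with p hp
      exact (isFlat_flatSection f p).eq_of_cone s t hst hp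
    exact ⟨fun _ => ht, fun h => ht.mul (hθ t h (hm (right_mem_Icc.2 hst))).inv⟩

end Holonomy

/-! ### The arcs of the suspension -/

/-- The loop that runs once along the arc over `x`. -/
def arc (x : X) : Path (base X) (base X) where
  toFun t := mk x t
  continuous_toFun := continuous_mk.comp (continuous_const.prodMk continuous_id)
  source' := mk_zero x
  target' := mk_one x

theorem arc_apply (x : X) (t : I) : arc x t = mk x t := rfl

theorem continuous_arc : Continuous (arc : X → Path (base X) (base X)) :=
  Path.continuous_uncurry_iff.1 continuous_mk

/-- The class of the arc over a point depends only on the path component of the point. -/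
def arcClass : ZerothHomotopy X → TopFundamentalGroup (SuspensionPlus X) (base X) :=
  Quotient.map arc fun _ _ ⟨γ⟩ => ⟨γ.map continuous_arc⟩

theorem continuous_arcClass :
    Continuous (arcClass : ZerothHomotopy X → TopFundamentalGroup (SuspensionPlus X) (base X)) :=
  continuous_arc.quotient_map' _

theorem holonomy_arcClass (f : ZerothHomotopy X → D) (c : ZerothHomotopy X) :
    holonomy f (arcClass c) = f c := by
  induction c using Quotient.ind with | _ x
  change flatSection f (arc x) 1 = f (ZerothHomotopy.mk x)
  have h := isFlat_flatSection f (arc x)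
  -- The arc lies in the cone before `1/4` and after `3/4`, and in the cylinder in between.
  obtain ⟨a, ha⟩ : ∃ a : I, (a : ℝ) = 1 / 4 := ⟨⟨1 / 4, by norm_num, by norm_num⟩, rfl⟩
  obtain ⟨b, hb⟩ : ∃ b : I, (b : ℝ) = 3 / 4 := ⟨⟨3 / 4, by norm_num, by norm_num⟩, rfl⟩
  have hab : a ≤ b := Subtype.coe_le_coe.1 (by norm_num [ha, hb])
  have h1 := h.eq_of_cone 0 a a.2.1 fun t ht => mk_mem_cone.2 <| Or.inl <| by
    have : (t : ℝ) ≤ (a : ℝ) := ht.2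
    linarith
  have h2 := h.eq_of_cylinder a b hab fun t ht => mk_mem_cylinder.2 ⟨by
      have : (a : ℝ) ≤ (t : ℝ) := ht.1
      exact unitInterval.coe_pos.1 (by linarith), by
      have : (t : ℝ) ≤ (b : ℝ) := ht.2
      exact unitInterval.coe_lt_one.1 (by linarith)⟩
  have h3 := h.eq_of_cone b 1 b.2.2 fun t ht => mk_mem_cone.2 <| Or.inr <| by
    have : (b : ℝ) ≤ (t : ℝ) := ht.1
    linarith
  rw [← h1, flatSection_zero, h3, arc_apply, arc_apply, transition_mk_of_le f x (by norm_num [ha]),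
    transition_mk_of_lt f x (by norm_num [hb]) (by norm_num [hb])] at h2
  rw [inv_one, mul_one] at h2
  exact (mul_inv_eq_one.1 h2.symm)

end SuspensionPlus

/-! ### Homotopies of paths coming from simply connected spaces -/

theorem Path.homotopic_of_forall_eq_map {T Y : Type*} [TopologicalSpace T] [TopologicalSpace Y]
    [SimplyConnectedSpace T] (K : C(T, Y)) {a b : T} (p q : Path a b) {y z : Y} {P Q : Path y z}
    (hP : ∀ t, P t = K (p t)) (hQ : ∀ t, Q t = K (q t)) : P.Homotopic Q := by
  obtain rfl : y = K a := by simpa using hP 0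
  obtain rfl : z = K b := by simpa using hP 1
  obtain rfl : P = p.map K.continuous := Path.ext (funext hP)
  obtain rfl : Q = q.map K.continuous := Path.ext (funext hQ)
  exact (SimplyConnectedSpace.paths_homotopic p q).map K

theorem Path.trans_apply_eq_map {T Y : Type*} [TopologicalSpace T] [TopologicalSpace Y]
    (K : T → Y) {a b c : T} {p : Path a b} {p' : Path b c} {x y z : Y} {P : Path x y}
    {P' : Path y z} (h : ∀ t, P t = K (p t)) (h' : ∀ t, P' t = K (p' t)) (t : I) :
    (P.trans P') t = K ((p.trans p') t) := by
  simp only [Path.trans_apply]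
  split_ifs
  · exact h _
  · exact h' _

/-- In a square whose top side is constant, the bottom side followed by the right side is
homotopic to the left side. -/
theorem Path.trans_homotopic_of_square {Y : Type*} [TopologicalSpace Y] {b b' c : Y}
    (K : C(I × I, Y)) {δ : Path b b'} {ρ : Path b c} {ρ' : Path b' c} (hδ : ∀ r, K (r, 0) = δ r)
    (hρ : ∀ t, K (0, t) = ρ t) (hρ' : ∀ t, K (1, t) = ρ' t) (hc : ∀ r, K (r, 1) = c) :
    (δ.trans ρ').Homotopic ρ := by
  let bottom : Path ((0 : I), (0 : I)) (1, 0) := ⟨⟨fun t => (t, 0), by fun_prop⟩, rfl, rfl⟩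
  let right : Path ((1 : I), (0 : I)) (1, 1) := ⟨⟨fun t => (1, t), by fun_prop⟩, rfl, rfl⟩
  let left : Path ((0 : I), (0 : I)) (0, 1) := ⟨⟨fun t => (0, t), by fun_prop⟩, rfl, rfl⟩
  let top : Path ((0 : I), (1 : I)) (1, 1) := ⟨⟨fun t => (t, 1), by fun_prop⟩, rfl, rfl⟩
  have h : (δ.trans ρ').Homotopic (ρ.trans (Path.refl c)) :=
    Path.homotopic_of_forall_eq_map K (bottom.trans right) (left.trans top)
      (Path.trans_apply_eq_map K (fun t => (hδ t).symm) fun t => (hρ' t).symm)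
      (Path.trans_apply_eq_map K (fun t => (hρ t).symm) fun t => (hc t).symm)
  exact h.trans ⟨Path.Homotopy.transRefl ρ⟩

namespace SuspensionPlus

variable {X : Type u}

/-! ### Generation of the fundamental group by the arcs -/

/-- A deformation of the interval, with parameter `s`, that ends by collapsing `[0, 1/3]` to `0`
and `[2/3, 1]` to `1`. -/
noncomputable def squeeze (s t : I) : I :=
  projIcc (0 : ℝ) 1 zero_le_one ((1 - s) * t + s * max 0 (min 1 (3 * (t : ℝ) - 1)))

theorem squeeze_of_le {s t : I} (ht : (t : ℝ) ≤ 1 / 3) : squeeze s t = σ s * t := by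
  have h : max (0 : ℝ) (min 1 (3 * (t : ℝ) - 1)) = 0 :=
    max_eq_left ((min_le_right _ _).trans (by linarith))
  rw [squeeze, h, mul_zero, add_zero]
  exact projIcc_of_mem zero_le_one (σ s * t).2

theorem squeeze_of_ge {s t : I} (ht : 2 / 3 ≤ (t : ℝ)) : squeeze s t = σ (σ s * σ t) := by
  have h : max (0 : ℝ) (min 1 (3 * (t : ℝ) - 1)) = 1 := by
    rw [min_eq_left (by linarith), max_eq_right zero_le_one]
  have h' : (1 - s : ℝ) * t + s * 1 = (σ (σ s * σ t) : I) := by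
    simp only [unitInterval.coe_symm_eq, Icc.coe_mul]
    ring
  rw [squeeze, h, h']
  exact projIcc_val zero_le_one _

theorem squeeze_zero_left (t : I) : squeeze 0 t = t := by
  simp [squeeze]

theorem continuous_squeeze : Continuous fun p : I × I => squeeze p.1 p.2 := by
  unfold squeeze
  fun_prop

variable [TopologicalSpace X]

/-- The homotopy of `Σ(X₊)` induced by `squeeze`, as a map to the space of paths. Its final stage
sends the cone to the basepoint. -/
noncomputable def deform : SuspensionPlus X → C(I, SuspensionPlus X) :=
  Quotient.lift
    (fun p => ⟨fun s => proj (p.1, squeeze s p.2), isQuotientMap_proj.continuous.comp <|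
      continuous_const.prodMk <| continuous_squeeze.comp (continuous_id.prodMk continuous_const)⟩)
    (by
      have key : ∀ p ∈ suspensionCollapse (AddDisjointPoint.pt X), ∀ s,
          proj (p.1, squeeze s p.2) = base X := by
        rintro ⟨z, t⟩ h s
        refine Quotient.sound (Or.inr ⟨?_, Or.inl rfl⟩)
        rcases h with h | h | h
        · have h : t = 0 := h
          exact Or.inl (by simp [h, squeeze_of_le])
        · have h : t = 1 := h
          refine Or.inr (Or.inl ?_)
          rw [h, squeeze_of_ge (by norm_num)]
          simp
        · exact Or.inr (Or.inr h)
      rintro p q (rfl | ⟨hp, hq⟩)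
      · rfl
      · ext s
        exact (key p hp s).trans (key q hq s).symm)

theorem deform_mk (x : X) (t s : I) : deform (mk x t) s = mk x (squeeze s t) := rfl

theorem deform_base (s : I) : deform (base X) s = base X := by
  refine (congrArg (fun t => proj (AddDisjointPoint.pt X, t)) ?_).trans (proj_inr 0)
  simp [squeeze_of_le]

theorem deform_zero (b : SuspensionPlus X) : deform b 0 = b := by
  rcases eq_base_or_eq_mk b with rfl | ⟨x, t, rfl⟩
  · exact deform_base 0
  · rw [deform_mk, squeeze_zero_left]

theorem deform_one {b : SuspensionPlus X} (hb : b ∈ cone X) : deform b 1 = base X := by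
  rcases eq_base_or_eq_mk b with rfl | ⟨x, t, rfl⟩
  · exact deform_base 1
  · rw [deform_mk]
    rcases mk_mem_cone.1 hb with h | h
    · rw [squeeze_of_le h.le]
      simpa using mk_zero x
    · rw [squeeze_of_ge h.le]
      simpa using mk_one x

theorem continuous_deform : Continuous (deform : SuspensionPlus X → C(I, SuspensionPlus X)) := by
  refine isQuotientMap_proj.continuous_iff.2 ?_
  refine ContinuousMap.continuous_of_continuous_uncurry _ ?_
  change Continuous fun q : (AddDisjointPoint X × I) × I => proj (q.1.1, squeeze q.2 q.1.2)
  exact isQuotientMap_proj.continuous.comp <| (continuous_fst.comp continuous_fst).prodMk <|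
    continuous_squeeze.comp (continuous_snd.prodMk (continuous_snd.comp continuous_fst))

/-- On the overlap of the cone and the cylinder, the path `deform b` to the basepoint agrees with
the path that moves down along the arc, possibly up to a turn around the arc. -/
theorem deform_homotopic {b : SuspensionPlus X} (hb : b ∈ cone X) {x : X} {s : I} (hx : b = mk x s)
    {ρ ρ' : Path b (base X)} (hρ : ∀ r, ρ r = deform b r) (hρ' : ∀ r, ρ' r = mk x (σ r * s)) :
    ρ = ρ' ∨ ρ.Homotopic (ρ'.trans (arc x)) := by
  subst hx
  rcases mk_mem_cone.1 hb with h | h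
  · left
    ext r
    rw [hρ, hρ', deform_mk, squeeze_of_le h.le]
  · right
    let up : Path s 1 := ⟨⟨fun r => σ (σ r * σ s), by fun_prop⟩, by simp, by simp⟩
    let down : Path s 0 := ⟨⟨fun r => σ r * s, by fun_prop⟩, by simp, by simp⟩
    let all : Path (0 : I) 1 := ⟨⟨fun r => r, by fun_prop⟩, rfl, rfl⟩
    let K : C(I, SuspensionPlus X) :=
      ⟨fun t => mk x t, continuous_mk.comp (continuous_const.prodMk continuous_id)⟩
    refine Path.homotopic_of_forall_eq_map K up (down.trans all) (fun r => ?_)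
      (Path.trans_apply_eq_map K hρ' fun t => rfl)
    rw [hρ, deform_mk, squeeze_of_ge h.le]
    rfl

/-- The initial segment of a loop. -/
def initialSegment (p : Path (base X) (base X)) (t : I) : Path (base X) (p t) :=
  (p.subpath 0 t).cast p.source.symm rfl

theorem initialSegment_trans_homotopic (p : Path (base X) (base X)) {s t : I}
    {ρ : Path (p s) (base X)} {ρ' : Path (p t) (base X)}
    (h : ((p.subpath s t).trans ρ').Homotopic ρ) :
    ((initialSegment p t).trans ρ').Homotopic ((initialSegment p s).trans ρ) := by
  have h1 : (initialSegment p t).Homotopic ((initialSegment p s).trans (p.subpath s t)) := by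
    have := Path.Homotopic.pathCast (⟨Path.Homotopy.subpathTransSubpath p 0 s t⟩)
      p.source.symm rfl
    exact this.symm
  exact (h1.hcomp (.refl ρ')).trans
    (Path.Homotopic.trans ⟨Path.Homotopy.transAssoc _ _ _⟩ ((Path.Homotopic.refl _).hcomp h))

/-- The class of the loop made of an initial segment of `p` and a path back to the basepoint. -/
noncomputable def closeUp (p : Path (base X) (base X)) (t : I) (ρ : Path (p t) (base X)) :
    TopFundamentalGroup (SuspensionPlus X) (base X) :=
  TopFundamentalGroup.mk ((initialSegment p t).trans ρ)

/-- The classes of the arcs generate the fundamental group. Each initial segment of a loop is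
closed up by a path to the basepoint, moving down along an arc in the cylinder and following
`deform` in the cone. The class of the resulting loop does not change along a subdivision interval
that is mapped to the cylinder, or to the cone, except for a possible turn around an arc when the
way of closing up is exchanged. -/
theorem closure_range_arcClass :
    Subgroup.closure (range (arcClass (X := X))) = ⊤ := by
  set H := Subgroup.closure (range (arcClass (X := X)))
  rw [eq_top_iff]
  rintro a -
  induction a using TopFundamentalGroup.ind with | _ p
  have harc : ∀ x, TopFundamentalGroup.mk (arc x) ∈ H := fun x =>
    Subgroup.subset_closure ⟨ZerothHomotopy.mk x, rfl⟩
  -- Exchanging the two ways of closing up does not affect membership in `H`.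
  have hswap : ∀ {t : I}, p t ∈ cone X → ∀ {x : X} {s : I}, p t = mk x s →
      ∀ {ρ ρ' : Path (p t) (base X)}, (∀ r, ρ r = deform (p t) r) →
      (∀ r, ρ' r = mk x (σ r * s)) →
      (closeUp p t ρ ∈ H ↔ closeUp p t ρ' ∈ H) := by
    intro t ht x s hx ρ ρ' hρ hρ'
    rcases deform_homotopic ht hx hρ hρ' with rfl | h
    · rfl
    · have : closeUp p t ρ =
          closeUp p t ρ' * TopFundamentalGroup.mk (arc x) :=
        TopFundamentalGroup.mk_eq_of_homotopic (((Path.Homotopic.refl _).hcomp h).trans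
          (Path.Homotopic.symm ⟨Path.Homotopy.transAssoc _ _ _⟩))
      rw [this]
      exact H.mul_mem_cancel_right (harc x)
  have hstep : ∀ {s t : I} {ρ : Path (p s) (base X)} {ρ' : Path (p t) (base X)},
      ((p.subpath s t).trans ρ').Homotopic ρ → closeUp p s ρ ∈ H →
      closeUp p t ρ' ∈ H := by
    intro s t ρ ρ' h hmem
    rwa [closeUp, TopFundamentalGroup.mk_eq_of_homotopic (initialSegment_trans_homotopic p h)]
  let down (x : X) (s : I) : Path (mk x s) (base X) :=
    ⟨⟨fun r => mk x (σ r * s), continuous_mk.comp (f := fun r : I => (x, σ r * s)) (by fun_prop)⟩,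
      by simp, by simp [mk_zero]⟩
  let close (b : SuspensionPlus X) (hb : b ∈ cone X) : Path b (base X) :=
    ⟨deform b, deform_zero b, deform_one hb⟩
  -- Every point has to carry the statement for both ways, since the cover may switch there.
  have key := induction_along p.continuous
    (P := fun t =>
      (∀ x s, 0 < s → s < 1 → p t = mk x s → ∀ ρ : Path (p t) (base X),
        (∀ r, ρ r = mk x (σ r * s)) → closeUp p t ρ ∈ H) ∧
      (p t ∈ cone X → ∀ ρ : Path (p t) (base X), (∀ r, ρ r = deform (p t) r) →
        closeUp p t ρ ∈ H)) ?_ ?_ ?_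
  · have h1 : p 1 ∈ cone X := p.target.symm ▸ base_mem_cone
    have h2 := key.2 h1 (close (p 1) h1) fun r => rfl
    have h3 : (initialSegment p 1).trans (close (p 1) h1) = p.trans (Path.refl _) := by
      ext t
      simp only [Path.trans_apply]
      split_ifs
      · simp [initialSegment]
      · exact (congrArg (fun b => deform b _) p.target).trans (deform_base _)
    rw [closeUp, h3, TopFundamentalGroup.mk_eq_of_homotopic ⟨Path.Homotopy.transRefl p⟩] at h2
    exact h2
  · refine ⟨fun x s h0 h1 hx => ?_, fun _ ρ hρ => ?_⟩
    · exact absurd ((hx ▸ p.source : mk x s = base X) ▸ mk_mem_cylinder.2 ⟨h0, h1⟩)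
        base_notMem_cylinder
    · have h3 : (initialSegment p 0).trans ρ = Path.refl (base X) := by
        ext t
        simp only [Path.trans_apply]
        split_ifs
        · simp [initialSegment]
        · rw [hρ, p.source, deform_base]
          rfl
      rw [closeUp, h3]
      exact H.one_mem
  · intro s t hst hm hs
    have hU : ∀ r, p.subpath s t r ∈ cylinder X := fun r => by
      obtain ⟨r', hr', h⟩ : p.subpath s t r ∈ p '' Icc s t :=
        p.range_subpath_of_le s t hst ▸ mem_range_self r
      exact h ▸ hm hr'
    obtain ⟨y, τ, hy⟩ := exists_coordinates (p.subpath s t).continuous hU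
    have hys : p s = mk (y 0) (τ 0) := (p.subpath s t).source.symm.trans (hy 0).2.2
    have hyt : p t = mk (y 1) (τ 1) := (p.subpath s t).target.symm.trans (hy 1).2.2
    have hfst : ∀ x u, 0 < u → u < 1 → p t = mk x u → ∀ ρ : Path (p t) (base X),
        (∀ r, ρ r = mk x (σ r * u)) → closeUp p t ρ ∈ H := by
      intro x u h0 h1 hx ρ hρ
      obtain ⟨rfl, rfl⟩ : y 1 = x ∧ τ 1 = u := by
        rcases mk_eq_mk_iff.1 (hyt.symm.trans hx) with h | ⟨-, h | h⟩
        · exact h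
        · exact absurd h h0.ne'
        · exact absurd h h1.ne
      refine hstep (ρ := (down (y 0) (τ 0)).cast hys rfl) ?_
        (hs.1 _ _ (hy 0).1 (hy 0).2.1 hys _ fun r => rfl)
      refine Path.trans_homotopic_of_square
        ⟨fun q => mk (y q.1) (σ q.2 * τ q.1),
          continuous_mk.comp (f := fun q : I × I => (y q.1, σ q.2 * τ q.1)) (by fun_prop)⟩
        (fun r => ?_) (fun r => rfl) (fun r => (hρ r).symm) fun r => ?_
      · simpa using (hy r).2.2.symm
      · simpa using mk_zero (y r)
    refine ⟨hfst, fun hV ρ hρ => ?_⟩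
    exact (hswap hV hyt hρ (ρ' := (down _ _).cast hyt rfl) fun r => rfl).2
      (hfst _ _ (hy 1).1 (hy 1).2.1 hyt _ fun r => rfl)
  · intro s t hst hm hs
    have hU : ∀ r, p.subpath s t r ∈ cone X := fun r => by
      obtain ⟨r', hr', h⟩ : p.subpath s t r ∈ p '' Icc s t :=
        p.range_subpath_of_le s t hst ▸ mem_range_self r
      exact h ▸ hm hr'
    have hVs : p s ∈ cone X := hm (left_mem_Icc.2 hst)
    have hVt : p t ∈ cone X := hm (right_mem_Icc.2 hst)
    have hsnd : ∀ ρ : Path (p t) (base X), (∀ r, ρ r = deform (p t) r) →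
        closeUp p t ρ ∈ H := by
      intro ρ hρ
      refine hstep (ρ := close (p s) hVs) ?_ (hs.2 hVs _ fun r => rfl)
      refine Path.trans_homotopic_of_square
        ⟨fun q => deform (p.subpath s t q.1) q.2,
          (continuous_deform.comp ((p.subpath s t).continuous.comp continuous_fst)).eval
            continuous_snd⟩
        (fun r => deform_zero _) (fun r => ?_) (fun r => ?_) fun r => deform_one (hU r)
      · exact congrArg (fun b => deform b r) (p.subpath s t).source
      · exact (congrArg (fun b => deform b r) (p.subpath s t).target).trans (hρ r).symm
    refine ⟨fun x u h0 h1 hx ρ hρ => ?_, fun _ => hsnd⟩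
    exact (hswap hVt hx (ρ := close (p t) hVt) (fun r => rfl) hρ).1 (hsnd _ fun r => rfl)

end SuspensionPlus

theorem mainTheorem4 (X : Type u) [TopologicalSpace X] :
    IsTopologicalGroup (TopFundamentalGroup (SuspensionPlus X) (SuspensionPlus.base X)) ↔
      Nonempty (TopFundamentalGroup (SuspensionPlus X) (SuspensionPlus.base X) ≃ₜ*
        FreeTopologicalGroup (ZerothHomotopy X)) := by
  refine ⟨fun h => ?_, fun ⟨e⟩ => e.isTopologicalGroup⟩
  obtain ⟨F, hF, -⟩ := FreeTopologicalGroup.existsUnique_lift SuspensionPlus.arcClass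
    (SuspensionPlus.continuous_arcClass (X := X))
  let Φ := SuspensionPlus.holonomy (X := X) FreeTopologicalGroup.of
  have hΦF : ∀ a, Φ (F a) = a := by
    have : Φ.comp (F : _ →* _) = MonoidHom.id (FreeTopologicalGroup (ZerothHomotopy X)) :=
      FreeGroup.ext_hom _ _ fun c =>
        (congrArg Φ (hF c)).trans (SuspensionPlus.holonomy_arcClass _ c)
    exact DFunLike.congr_fun this
  have hFΦ : ∀ a, F (Φ a) = a := by
    have : (F : _ →* _).comp Φ = MonoidHom.id _ :=
      MonoidHom.eq_of_eqOn_dense SuspensionPlus.closure_range_arcClass <| by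
        rintro _ ⟨c, rfl⟩
        exact (congrArg F (SuspensionPlus.holonomy_arcClass _ c)).trans (hF c)
    exact DFunLike.congr_fun this
  exact ⟨{ Φ with
    invFun := F
    left_inv := hFΦ
    right_inv := hΦF
    continuous_toFun := SuspensionPlus.continuous_holonomy FreeTopologicalGroup.continuous_of
    continuous_invFun := F.continuous_toFun }⟩
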